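/- Let $q=p^m$ with $p$ prime and $m\ge 1$, and let $\mathbb{F}_q$ be the field with $q$ elements. For $k\ge 1$ put $R_k=\{x^k : x\in\mathbb{F}_q^*\}$. The generalized Paley graph $\Gamma(k,q)$ has vertex set $\mathbb{F}_q$, with an arrow from $v$ to $w$ if and only if $w-v\in R_k$; the generalized Paley sum graph $\Gamma^+(k,q)$ has vertex set $\mathbb{F}_q$, with an arrow from $v$ to $w$ if and only if $v+w\in R_k$ (so there is a loop at $v$ whenever $v+v\in R_k$); and $\bar\Gamma(k,q)$ is the loopless complement of $\Gamma(k,q)$. The spectrum of a graph is the multiset of eigenvalues of its adjacency matrix (a loop contributes $1$ on the diagonal), and its energy is the sum of the absolute values of the eigenvalues, counted with multiplicity. Two graphs with the same number of vertices are isospectral if they have the same spectrum (with multiplicities), and equienergetic if they have the same energy. An eigenvalue of a regular graph is non-principal if it differs from the degree of regularity. The pair $(k,q)$ is semiprimitive if $-1$ is congruent to a power of $p$ modulo $k$. **Theorem 4.2.** Let $q=p^m$ with $p$ prime and $m\ge 1$, and let $k\in\{3,4\}$ be such that $k\mid\frac{q-1}{p-1}$ and $(k,q)$ is not a semiprimitive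 pair. Then $\Gamma(k,q)$ and $\bar\Gamma(k,q)$ are equienergetic if and only if exactly one of the distinct non-principal eigenvalues of $\Gamma(k,q)$ is positive. In this case the graphs $\Gamma(k,q)$, $\Gamma^+(k,q)$ and $\bar\Gamma(k,q)$ are mutually equienergetic and pairwise non-isospectral. -/

import Mathlib

noncomputable section

namespace PaleyEnergy

/-- The Cayley graph `X(G, S)`: an arrow from `v` to `w` whenever `w - v ∈ S`. -/
def cayleyGraph {G : Type*} [AddCommGroup G] (S : Set G) : Digraph G where
  Adj v w := w - v ∈ S

/-- The Cayley sum graph `X⁺(G, S)`: an arrow from `v` to `w` whenever `v + w ∈ S`.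
There is a loop at `x` when `x + x ∈ S`. -/
def cayleySumGraph {G : Type*} [AddCommGroup G] (S : Set G) : Digraph G where
  Adj v w := v + w ∈ S

/-- The graph-theoretic complement: distinct vertices are adjacent exactly when they are not
adjacent in `Γ`, and there are no loops. (Mathlib's `Γᶜ` for digraphs would put a loop at every
loopless vertex.) -/
def complement {V : Type*} (Γ : Digraph V) : Digraph V where
  Adj v w := v ≠ w ∧ ¬ Γ.Adj v w

/-- The set `R_k` of nonzero `k`-th powers of a field. -/
def nonzeroPowers (k : ℕ) (F : Type*) [Field F] : Set F :=
  {y | ∃ x : F, x ≠ 0 ∧ x ^ k = y}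

/-- The generalized Paley graph `Γ(k, q)`, where `q` is the size of the finite field `F`. -/
def gpGraph (k : ℕ) (F : Type*) [Field F] : Digraph F :=
  cayleyGraph (nonzeroPowers k F)

/-- The generalized Paley sum graph `Γ⁺(k, q)`, where `q` is the size of the finite field `F`. -/
def gpSumGraph (k : ℕ) (F : Type*) [Field F] : Digraph F :=
  cayleySumGraph (nonzeroPowers k F)

open Classical in
/-- The adjacency matrix; a loop contributes `1` to the diagonal. -/
def adjacencyMatrix {V : Type*} (Γ : Digraph V) : Matrix V V ℂ :=
  Matrix.of fun v w => if Γ.Adj v w then 1 else 0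

open Classical in
/-- The spectrum of a finite graph: the eigenvalues of the adjacency matrix, counted with
algebraic multiplicity (as many as there are vertices). -/
def spec {V : Type*} [Fintype V] (Γ : Digraph V) : Multiset ℂ :=
  (adjacencyMatrix Γ).charpoly.roots

/-- The energy: the sum of the absolute values of the eigenvalues, with multiplicity. -/
def energy {V : Type*} [Fintype V] (Γ : Digraph V) : ℝ :=
  ((spec Γ).map fun z => ‖z‖).sum

/-- Two graphs are isospectral if they have the same eigenvalues with the same multiplicities. -/
def Isospectral {V W : Type*} [Fintype V] [Fintype W] (Γ₁ : Digraph V) (Γ₂ : Digraph W) : Prop :=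
  spec Γ₁ = spec Γ₂

/-- Two graphs with the same number of vertices are equienergetic if their energies agree. -/
def Equienergetic {V W : Type*} [Fintype V] [Fintype W] (Γ₁ : Digraph V) (Γ₂ : Digraph W) :
    Prop :=
  Fintype.card V = Fintype.card W ∧ energy Γ₁ = energy Γ₂

/-- Every vertex has exactly `d` out-neighbours (a loop counts once). -/
def IsRegular {V : Type*} (Γ : Digraph V) (d : ℕ) : Prop :=
  ∀ v, {w | Γ.Adj v w}.ncard = d

/-- A real number `x` is a non-principal eigenvalue of `Γ` if it is an eigenvalue different from
the degree of regularity of `Γ`. -/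
def IsNonPrincipalEigenvalue {V : Type*} [Fintype V] (Γ : Digraph V) (x : ℝ) : Prop :=
  (x : ℂ) ∈ spec Γ ∧ ∀ d : ℕ, IsRegular Γ d → x ≠ d

/-- `(k, q)` is a semiprimitive pair: `q` is a power of a prime `p` and `-1` is congruent to
a power of `p` modulo `k`. -/
def IsSemiprimitivePair (k q : ℕ) : Prop :=
  ∃ p m j : ℕ, p.Prime ∧ 0 < m ∧ q = p ^ m ∧ k ∣ p ^ j + 1

end PaleyEnergy

end

/-! Write `q = k * n + 1`. The additive characters diagonalise `Γ(k, q)`: its eigenvalues are `n`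
and the periods `η i`, `i < k`, one per coset of `R_k`, each counted `n` times. As `R_k` contains
the nonzero elements of the prime field, the periods are integers, congruent to `n` mod `p`, hence
nonzero. The complement has eigenvalues `(k - 1) * n` and `-1 - η i`. Since `|1 + η| = |η| ± 1`
according to the sign of `η`, the two energies differ by `2 * n * (c - 1)`, where `c` is the number
of cosets with `0 ≤ η i` (`equienergetic_complement_iff`).

It remains to pass from cosets to distinct values. If `k - 1` periods coincided, the first three
power moments would force `p` to divide `9 * T + 8` (`k = 3`) or `16 * T + 11` (`k = 4`), where `T`
is `powersCount`. Modulo `p` these are `-C` and `-3 * C` with `C = (2 * n).choose n`. Failure of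
semiprimitivity gives `k ∣ p - 1`, whence `p ∤ C` (`not_dvd_choose_two_mul`). For `k = 4`, pairs of
equal positive periods are handled by the quadratic periods (`four_periods_cases`).

The Cayley and sum graphs have adjacency matrices with equal squares, hence equal energies. Traces
separate the sum graph from the two loopless graphs, and the degree `(k - 1) * n` separates the
complement from `Γ(k, q)`. -/

open Finset Matrix

namespace PaleyEnergy

/-! ### Spectra of Cayley graphs by additive characters, and their moments. -/

section Spectrum

variable {F : Type*} [Field F] [Fintype F]

/-- The eigenvalue of the Cayley graph `X(F, S)` at the character `x ↦ ψ (a * x)`. -/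
noncomputable def charSum {F : Type*} [Field F] (ψ : AddChar F ℂ) (S : Finset F)
    (a : F) : ℂ := ∑ s ∈ S, ψ (a * s)

lemma charSum_zero {F : Type*} [Field F] (ψ : AddChar F ℂ) (S : Finset F) :
    charSum ψ S 0 = S.card := by
  simp [charSum]

open Classical in
/-- The matrix whose columns are the additive characters of `F`. -/
noncomputable def charMatrix {F : Type*} [Field F] (ψ : AddChar F ℂ) : Matrix F F ℂ :=
  Matrix.of fun v a => ψ (a * v)

open Classical in
lemma charMatrix_isUnit {ψ : AddChar F ℂ} (hψ : ψ.IsPrimitive) : IsUnit (charMatrix ψ) := by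
  have hq : (Fintype.card F : ℂ) ≠ 0 := by exact_mod_cast Fintype.card_ne_zero
  have h : charMatrix ψ *
      ((Fintype.card F : ℂ)⁻¹ • Matrix.of fun a w => ψ (-(a * w))) = 1 := by
    ext v w
    rw [Matrix.mul_smul, Matrix.smul_apply, Matrix.mul_apply]
    have : ∀ a : F, charMatrix ψ v a * (Matrix.of fun a w => ψ (-(a * w))) a w
        = ψ (a * (v - w)) := by
      intro a
      simp only [charMatrix, Matrix.of_apply, ← AddChar.map_add_eq_mul]
      congr 1; ring
    rw [Finset.sum_congr rfl fun a _ => this a, AddChar.sum_mulShift _ hψ, Matrix.one_apply]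
    by_cases hvw : v = w
    · simp [hvw, hq]
    · simp [hvw, sub_eq_zero]
  exact (IsUnit.of_mul_eq_one _ h)

open Classical in
lemma adjacencyMatrix_mul_charMatrix (ψ : AddChar F ℂ) (S : Finset F) :
    adjacencyMatrix (cayleyGraph (S : Set F)) * charMatrix ψ
      = charMatrix ψ * Matrix.diagonal (charSum ψ S) := by
  ext v a
  rw [Matrix.mul_apply, Matrix.mul_diagonal]
  simp only [adjacencyMatrix, cayleyGraph, charMatrix, Matrix.of_apply, charSum, Finset.mul_sum,
    ite_mul, one_mul, zero_mul, Finset.mem_coe]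
  rw [← Finset.sum_filter]
  -- Each character is an eigenvector: substitute `w = s + v`.
  refine Finset.sum_nbij' (fun w => w - v) (fun s => s + v) ?_ ?_ ?_ ?_ ?_ <;>
    simp +contextual [← AddChar.map_add_eq_mul, ← mul_add]

open Classical in
theorem spec_cayleyGraph {ψ : AddChar F ℂ} (hψ : ψ.IsPrimitive) (S : Finset F) :
    spec (cayleyGraph (S : Set F)) = Finset.univ.val.map (charSum ψ S) := by
  obtain ⟨u, hu⟩ := charMatrix_isUnit hψ
  have h := adjacencyMatrix_mul_charMatrix ψ S
  have h2 : adjacencyMatrix (cayleyGraph (S : Set F))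
      = u.val * Matrix.diagonal (charSum ψ S) * u.val⁻¹ := by
    rw [hu, ← h, ← hu, mul_assoc, ← Matrix.coe_units_inv, Units.mul_inv, mul_one]
  unfold spec
  rw [h2, Matrix.charpoly_units_conj, Matrix.charpoly_diagonal, Polynomial.roots_prod]
  · simp
  · exact Finset.prod_ne_zero_iff.2 fun a _ => Polynomial.X_sub_C_ne_zero _

open Classical in
lemma charSum_compl {ψ : AddChar F ℂ} (hψ : ψ.IsPrimitive) {S : Finset F} (h0 : (0 : F) ∉ S)
    (a : F) : charSum ψ (Sᶜ.erase 0) a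
      = (if a = 0 then (Fintype.card F : ℂ) else 0) - 1 - charSum ψ S a := by
  have h : ∑ x, ψ (a * x) = if a = 0 then (Fintype.card F : ℂ) else 0 := by
    simp_rw [mul_comm a]; exact_mod_cast AddChar.sum_mulShift a hψ
  rw [← h, ← Finset.sum_compl_add_sum S, charSum,
    ← Finset.add_sum_erase Sᶜ _ (Finset.mem_compl.2 h0)]
  unfold charSum
  simp only [mul_zero, AddChar.map_zero_eq_one]
  ring

open Classical in
lemma complement_cayleyGraph (S : Finset F) :
    complement (cayleyGraph (S : Set F)) = cayleyGraph ((Sᶜ.erase 0 : Finset F) : Set F) := by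
  ext v w
  simp [complement, cayleyGraph, sub_eq_zero, eq_comm, and_comm]

lemma sum_charSum {ψ : AddChar F ℂ} (hψ : ψ.IsPrimitive) {S : Finset F} (h0 : (0 : F) ∉ S) :
    ∑ a, charSum ψ S a = 0 := by
  classical
  simp_rw [charSum]
  rw [Finset.sum_comm]
  refine Finset.sum_eq_zero fun s hs => ?_
  rw [AddChar.sum_mulShift _ hψ, if_neg (ne_of_mem_of_not_mem hs h0), Nat.cast_zero]

/-- Orthogonality leaves `q` times the number of pairs in `S` with `s + t = 0`. -/
lemma sum_charSum_sq {ψ : AddChar F ℂ} (hψ : ψ.IsPrimitive) {S : Finset F}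
    (hS : ∀ s ∈ S, -s ∈ S) : ∑ a, charSum ψ S a ^ 2 = Fintype.card F * S.card := by
  classical
  simp_rw [pow_two, charSum, Finset.sum_mul_sum, ← AddChar.map_add_eq_mul, ← mul_add]
  rw [Finset.sum_comm]
  have : ∀ s ∈ S, ∑ a, ∑ t ∈ S, ψ (a * (s + t)) = Fintype.card F := by
    intro s hs
    rw [Finset.sum_comm]
    simp_rw [AddChar.sum_mulShift _ hψ, add_comm s, ← eq_neg_iff_add_eq_zero]
    simp [hS s hs]
  rw [Finset.sum_congr rfl this]
  simp [mul_comm]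

-- Orthogonality counts triples in `S` with `r + s + t = 0`; dividing by `-r` turns each into a
-- solution of `s' + t' = 1` in `S`.
open Classical in
lemma sum_charSum_cube {ψ : AddChar F ℂ} (hψ : ψ.IsPrimitive) {S : Finset F}
    (hS : ∀ s ∈ S, -s ∈ S) (h0 : (0 : F) ∉ S) (hmul : ∀ r ∈ S, ∀ x, r * x ∈ S ↔ x ∈ S) :
    ∑ a, charSum ψ S a ^ 3
      = Fintype.card F * S.card * (S.filter fun s => 1 - s ∈ S).card := by
  have hneg : ∀ s, -s ∈ S ↔ s ∈ S := fun s => ⟨fun h => by simpa using hS _ h, hS s⟩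
  have key : ∀ r ∈ S, ∑ a, ∑ s ∈ S, ∑ t ∈ S, ψ (a * (r + s + t))
      = Fintype.card F * (S.filter fun s => 1 - s ∈ S).card := by
    intro r hr
    have hr0 : r ≠ 0 := ne_of_mem_of_not_mem hr h0
    rw [Finset.sum_comm]
    have : ∀ s ∈ S, ∑ a, ∑ t ∈ S, ψ (a * (r + s + t))
        = if r + s ∈ S then (Fintype.card F : ℂ) else 0 := by
      intro s hs
      rw [Finset.sum_comm]
      simp_rw [AddChar.sum_mulShift _ hψ, add_comm (r + s), ← eq_neg_iff_add_eq_zero]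
      simp only [Nat.cast_ite, Nat.cast_zero, Finset.sum_ite_eq', hneg]
    rw [Finset.sum_congr rfl this, ← Finset.sum_filter, Finset.sum_const, nsmul_eq_mul, mul_comm]
    congr 2
    refine Finset.card_nbij' (fun s => -(r⁻¹ * s)) (fun s => -(r * s)) ?_ ?_ ?_ ?_
    · intro s hs
      simp only [Finset.coe_filter, Set.mem_ofPred_eq] at hs ⊢
      rw [hneg, ← hmul r hr, ← hmul r hr (1 - _)]
      simpa [mul_sub, mul_add, hr0] using hs
    · intro s hs
      simp only [Finset.coe_filter, Set.mem_ofPred_eq] at hs ⊢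
      rw [hneg, hmul r hr]
      refine ⟨hs.1, ?_⟩
      have := (hmul r hr _).2 hs.2
      rwa [mul_sub, mul_one, sub_eq_add_neg] at this
    · intro s _; simp [hr0]
    · intro s _; simp [hr0]
  have : ∀ a, charSum ψ S a ^ 3 = ∑ r ∈ S, ∑ s ∈ S, ∑ t ∈ S, ψ (a * (r + s + t)) := by
    intro a
    unfold charSum
    rw [pow_succ, pow_two, Finset.sum_mul_sum, Finset.sum_mul]
    simp_rw [Finset.sum_mul_sum, ← AddChar.map_add_eq_mul, ← mul_add]
  simp_rw [this]
  rw [Finset.sum_comm, Finset.sum_congr rfl key, Finset.sum_const, nsmul_eq_mul]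
  ring

end Spectrum

/-! ### Energy of symmetric graphs; Cayley graphs against sum graphs. -/

section Energy

-- Unitary diagonalisation squares the eigenvalues, so the energy depends only on the square of the
-- adjacency matrix.
open Classical in
lemma energy_eq_of_isHermitian {V : Type*} [Fintype V] (Γ : Digraph V)
    (h : (adjacencyMatrix Γ).IsHermitian) :
    energy Γ = ((((adjacencyMatrix Γ) ^ 2).charpoly.roots).map fun z => √‖z‖).sum := by
  have hsq : ((adjacencyMatrix Γ) ^ 2).charpoly.roots
      = (adjacencyMatrix Γ).charpoly.roots.map fun z => z ^ 2 := by
    conv_lhs => rw [h.spectral_theorem, ← map_pow, Unitary.conjStarAlgAut_apply,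
      Matrix.charpoly_mul_comm, ← mul_assoc]
    rw [h.roots_charpoly_eq_eigenvalues, Unitary.coe_star_mul_self, one_mul, Matrix.diagonal_pow,
      Matrix.charpoly_diagonal, Polynomial.roots_prod]
    · simp [Multiset.map_map, Function.comp_def, -map_pow]
    · exact Finset.prod_ne_zero_iff.2 fun a _ => Polynomial.X_sub_C_ne_zero _
  rw [energy, spec, hsq, Multiset.map_map]
  congr 1
  refine Multiset.map_congr rfl fun z _ => ?_
  simp [Real.sqrt_sq]

lemma energy_eq_of_sq_eq {V : Type*} [Fintype V] {Γ₁ Γ₂ : Digraph V}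
    (h₁ : (adjacencyMatrix Γ₁).IsHermitian) (h₂ : (adjacencyMatrix Γ₂).IsHermitian)
    (h : adjacencyMatrix Γ₁ * adjacencyMatrix Γ₁ = adjacencyMatrix Γ₂ * adjacencyMatrix Γ₂) :
    energy Γ₁ = energy Γ₂ := by
  classical
  rw [energy_eq_of_isHermitian _ h₁, energy_eq_of_isHermitian _ h₂, pow_two, pow_two, h]

lemma isHermitian_adjacencyMatrix {V : Type*} {Γ : Digraph V}
    (h : ∀ v w, Γ.Adj v w ↔ Γ.Adj w v) : (adjacencyMatrix Γ).IsHermitian := by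
  ext v w
  simp only [adjacencyMatrix, Matrix.conjTranspose_apply, Matrix.of_apply]
  by_cases hvw : Γ.Adj v w
  · simp [hvw, (h v w).1 hvw]
  · simp [hvw, mt (h v w).2 hvw]

lemma sum_spec {V : Type*} [Fintype V] (Γ : Digraph V) :
    (spec Γ).sum = (adjacencyMatrix Γ).trace := by
  classical
  rw [spec, Matrix.trace_eq_sum_roots_charpoly]

lemma sum_spec_of_loopless {V : Type*} [Fintype V] {Γ : Digraph V} (h : ∀ v, ¬ Γ.Adj v v) :
    (spec Γ).sum = 0 := by
  rw [sum_spec, Matrix.trace]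
  simp [adjacencyMatrix, h]

variable {G : Type*} [AddCommGroup G] [Fintype G]

theorem energy_cayleyGraph_eq_energy_cayleySumGraph {S : Set G} (hS : ∀ s, -s ∈ S ↔ s ∈ S) :
    energy (cayleyGraph S) = energy (cayleySumGraph S) := by
  classical
  refine energy_eq_of_sq_eq (isHermitian_adjacencyMatrix fun v w => ?_)
    (isHermitian_adjacencyMatrix fun v w => ?_) ?_
  · simp only [cayleyGraph]
    rw [← hS, neg_sub]
  · simp only [cayleySumGraph, add_comm]
  · ext v w
    -- Replacing the middle vertex `u` by `-u` turns differences into sums, up to the symmetry of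
    -- `S`.
    rw [Matrix.mul_apply, Matrix.mul_apply, ← Equiv.sum_comp (Equiv.neg G)]
    refine Finset.sum_congr rfl fun u _ => ?_
    have h1 : -u - v ∈ S ↔ v + u ∈ S := by rw [← hS]; congr! 1; abel
    have h2 : w - -u ∈ S ↔ u + w ∈ S := by congr! 1; abel
    simp only [adjacencyMatrix, cayleyGraph, cayleySumGraph, Matrix.of_apply, Equiv.neg_apply,
      h1, h2]
    congr!

end Energy

/-! ### Cosets of the group of `k`-th powers. -/

section Cosets

variable {F : Type*} [Field F] [Fintype F]

lemma exists_isPrimitiveRoot_card_sub_one (F : Type*) [Field F] [Fintype F] :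
    ∃ g : F, IsPrimitiveRoot g (Fintype.card F - 1) := by
  obtain ⟨u, hu⟩ := IsCyclic.exists_generator (α := Fˣ)
  refine ⟨u, IsPrimitiveRoot.coe_units_iff.2 ?_⟩
  classical
  rw [← Fintype.card_units, ← Nat.card_eq_fintype_card, ← orderOf_eq_card_of_forall_mem_zpowers hu]
  exact IsPrimitiveRoot.orderOf u

lemma sum_eq_add_sum_pow_generator {M : Type*} [AddCommMonoid M] {g : F} {N : ℕ}
    (hN : Fintype.card F = N + 1) (hg : IsPrimitiveRoot g N) (hN0 : N ≠ 0) (f : F → M) :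
    ∑ a, f a = f 0 + ∑ j ∈ range N, f (g ^ j) := by
  classical
  have himg : univ.erase (0 : F) = (range N).image (g ^ ·) := by
    symm
    apply Finset.eq_of_subset_of_card_le
    · intro x hx
      obtain ⟨j, -, rfl⟩ := Finset.mem_image.1 hx
      simpa using pow_ne_zero j (hg.ne_zero hN0)
    · rw [Finset.card_image_of_injOn]
      · simp [hN]
      · intro i hi j hj h
        exact hg.pow_inj (by simpa using hi) (by simpa using hj) h
  rw [← Finset.add_sum_erase univ f (Finset.mem_univ 0), himg, Finset.sum_image]
  intro i hi j hj h
  exact hg.pow_inj (by simpa using hi) (by simpa using hj) h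

lemma exists_pow_generator {g : F} {N : ℕ}
    (hN : Fintype.card F = N + 1) (hg : IsPrimitiveRoot g N) {a : F} (ha : a ≠ 0) :
    ∃ j < N, g ^ j = a := by
  have hN0 : N ≠ 0 := by
    rintro rfl
    have := Fintype.one_lt_card (α := F)
    omega
  have : NeZero N := ⟨hN0⟩
  refine hg.eq_pow_of_pow_eq_one ?_
  have := FiniteField.pow_card_sub_one_eq_one a ha
  rwa [hN] at this

open Classical in
/-- The set `R_k` of nonzero `k`-th powers of a finite field, as a finite set. -/
noncomputable def powers (k : ℕ) (F : Type*) [Field F] [Fintype F] : Finset F :=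
  (nonzeroPowers k F).toFinset

lemma mem_powers {k : ℕ} {y : F} : y ∈ powers k F ↔ ∃ x : F, x ≠ 0 ∧ x ^ k = y := by
  simp only [powers, Set.mem_toFinset]
  rfl

lemma gpGraph_eq (k : ℕ) : gpGraph k F = cayleyGraph (powers k F : Set F) := by
  simp [gpGraph, powers]

lemma zero_notMem_powers {k : ℕ} : (0 : F) ∉ powers k F := by
  rw [mem_powers]
  rintro ⟨x, hx, h⟩
  exact pow_ne_zero k hx h

lemma one_mem_powers {k : ℕ} : (1 : F) ∈ powers k F := mem_powers.2 ⟨1, one_ne_zero, one_pow k⟩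

lemma mul_mem_powers_iff {k : ℕ} {r : F} (hr : r ∈ powers k F) (x : F) :
    r * x ∈ powers k F ↔ x ∈ powers k F := by
  obtain ⟨y, hy, rfl⟩ := mem_powers.1 hr
  rw [mem_powers, mem_powers]
  constructor
  · rintro ⟨z, hz, h⟩
    exact ⟨y⁻¹ * z, mul_ne_zero (inv_ne_zero hy) hz, by
      rw [mul_pow, h, ← mul_assoc, ← mul_pow, inv_mul_cancel₀ hy, one_pow, one_mul]⟩
  · rintro ⟨z, hz, h⟩
    exact ⟨y * z, mul_ne_zero hy hz, by rw [mul_pow, h]⟩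

lemma mem_powers_iff_pow_eq_one {k n : ℕ} (hn : 0 < n) (hkn : Fintype.card F = k * n + 1) {x : F} :
    x ∈ powers k F ↔ x ^ n = 1 := by
  obtain ⟨g, hg⟩ := exists_isPrimitiveRoot_card_sub_one F
  rw [hkn, Nat.add_sub_cancel] at hg
  have hk : 0 < k := by
    rcases Nat.eq_zero_or_pos k with rfl | h
    · have := Fintype.one_lt_card (α := F)
      omega
    · exact h
  constructor
  · intro h
    obtain ⟨y, hy, rfl⟩ := mem_powers.1 h
    have := FiniteField.pow_card_sub_one_eq_one y hy
    rwa [hkn, Nat.add_sub_cancel, pow_mul] at this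
  · intro h
    have hx : x ≠ 0 := by
      rintro rfl
      rw [zero_pow hn.ne'] at h
      exact zero_ne_one h
    obtain ⟨j, -, rfl⟩ := exists_pow_generator hkn hg hx
    rw [← pow_mul, hg.pow_eq_one_iff_dvd] at h
    obtain ⟨l, rfl⟩ := Nat.dvd_of_mul_dvd_mul_right hn h
    exact mem_powers.2 ⟨g ^ l, pow_ne_zero _ (hg.ne_zero (by positivity)),
      by rw [← pow_mul, mul_comm]⟩

lemma powers_eq_image [DecidableEq F] {k n : ℕ} (hn : 0 < n) (hkn : Fintype.card F = k * n + 1)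
    {g : F} (hg : IsPrimitiveRoot g (k * n)) :
    powers k F = (range n).image (fun l => g ^ (k * l)) := by
  ext x
  rw [mem_powers_iff_pow_eq_one hn hkn, Finset.mem_image]
  have : NeZero n := ⟨hn.ne'⟩
  have hk : k ≠ 0 := by
    rintro rfl
    have := Fintype.one_lt_card (α := F)
    omega
  have hgk : IsPrimitiveRoot (g ^ k) n := hg.pow (by positivity) rfl
  constructor
  · intro h
    obtain ⟨l, hl, rfl⟩ := hgk.eq_pow_of_pow_eq_one h
    exact ⟨l, by simpa using hl, by rw [pow_mul]⟩
  · rintro ⟨l, -, rfl⟩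
    rw [pow_mul, ← pow_mul, mul_comm l, pow_mul, hgk.pow_eq_one, one_pow]

lemma sum_powers {M : Type*} [AddCommMonoid M] {k n : ℕ} (hn : 0 < n)
    (hkn : Fintype.card F = k * n + 1) {g : F} (hg : IsPrimitiveRoot g (k * n)) (f : F → M) :
    ∑ s ∈ powers k F, f s = ∑ l ∈ range n, f (g ^ (k * l)) := by
  classical
  rw [powers_eq_image hn hkn hg, Finset.sum_image]
  intro i hi j hj h
  have hk : 0 < k := by
    rcases Nat.eq_zero_or_pos k with rfl | h
    · have := Fintype.one_lt_card (α := F)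
      omega
    · exact h
  have hi : i < n := by simpa using hi
  have hj : j < n := by simpa using hj
  exact Nat.eq_of_mul_eq_mul_left hk (hg.pow_inj (Nat.mul_lt_mul_of_pos_left hi hk)
    (Nat.mul_lt_mul_of_pos_left hj hk) h)

lemma card_powers {k n : ℕ} (hn : 0 < n) (hkn : Fintype.card F = k * n + 1) :
    (powers k F).card = n := by
  obtain ⟨g, hg⟩ := exists_isPrimitiveRoot_card_sub_one F
  rw [hkn, Nat.add_sub_cancel] at hg
  rw [Finset.card_eq_sum_ones, sum_powers hn hkn hg]
  simp

lemma charSum_powers_mul (ψ : AddChar F ℂ) {k : ℕ} {r : F} (hr : r ∈ powers k F) (a : F) :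
    charSum ψ (powers k F) (r * a) = charSum ψ (powers k F) a := by
  have hr0 : r ≠ 0 := ne_of_mem_of_not_mem hr zero_notMem_powers
  unfold charSum
  refine Finset.sum_nbij' (fun s => r * s) (fun s => r⁻¹ * s) ?_ ?_ ?_ ?_ ?_
  · intro s hs; exact (mul_mem_powers_iff hr s).2 hs
  · intro s hs; rw [← mul_mem_powers_iff hr]; simpa [hr0] using hs
  · intro s _; simp [hr0]
  · intro s _; simp [hr0]
  · intro s _; congr 1; ring

lemma sum_range_mul_of_periodic {M : Type*} [AddCommMonoid M] {f : ℕ → M} {k : ℕ}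
    (hf : Function.Periodic f k) (n : ℕ) :
    ∑ j ∈ range (k * n), f j = n • ∑ j ∈ range k, f j := by
  induction n with
  | zero => simp
  | succ n ih =>
    rw [Nat.mul_succ, Finset.sum_range_add, ih, succ_nsmul]
    congr 1
    refine Finset.sum_congr rfl fun i _ => ?_
    have := hf.nat_mul n i
    rwa [Nat.cast_id, mul_comm n k, add_comm] at this

/-- A sum over the field of a quantity depending only on the eigenvalue of the Paley graph
reduces to a sum over the `k` cosets of `R_k`. -/
lemma sum_comp_charSum {M : Type*} [AddCommMonoid M] {k n : ℕ} (hn : 0 < n)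
    (hkn : Fintype.card F = k * n + 1) {g : F} (hg : IsPrimitiveRoot g (k * n))
    (ψ : AddChar F ℂ) (f : ℂ → M) :
    ∑ a, f (charSum ψ (powers k F) a)
      = f n + n • ∑ i ∈ range k, f (charSum ψ (powers k F) (g ^ i)) := by
  have hk : k * n ≠ 0 := by
    have := Fintype.one_lt_card (α := F)
    omega
  rw [sum_eq_add_sum_pow_generator hkn hg hk (fun a => f (charSum ψ (powers k F) a)),
    charSum_zero, card_powers hn hkn]
  congr 1
  refine sum_range_mul_of_periodic (f := fun j => f (charSum ψ (powers k F) (g ^ j))) ?_ n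
  intro j
  simp only
  rw [pow_add, mul_comm, charSum_powers_mul ψ (mem_powers.2 ⟨g, hg.ne_zero hk, rfl⟩)]

end Cosets

/-! ### The periods are integers. -/

section Integrality

variable {F : Type*} [Field F] [Fintype F]

lemma exists_int_eq_of_isIntegral_of_mul_eq {z : ℂ} (hz : IsIntegral ℤ z) {a b : ℤ} (ha : a ≠ 0)
    (h : (a : ℂ) * z = b) : ∃ c : ℤ, z = c := by
  have ha' : (a : ℂ) ≠ 0 := by exact_mod_cast ha
  have hz2 : z = algebraMap ℚ ℂ ((b : ℚ) / a) := by
    rw [eq_ratCast]; push_cast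
    rw [eq_div_iff ha', mul_comm, h]
  rw [hz2, isIntegral_algebraMap_iff (algebraMap ℚ ℂ).injective] at hz
  obtain ⟨c, hc⟩ := IsIntegrallyClosed.isIntegral_iff.1 hz
  refine ⟨c, ?_⟩
  rw [hz2, ← hc]
  simp

lemma isIntegral_charSum {F : Type*} [Field F] {p : ℕ} [Fact p.Prime] [CharP F p]
    (ψ : AddChar F ℂ) (S : Finset F) (a : F) : IsIntegral ℤ (charSum ψ S a) := by
  refine IsIntegral.sum _ fun s _ => ?_
  refine IsIntegral.of_pow (n := p) (Fact.out : p.Prime).pos ?_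
  rw [← AddChar.map_nsmul_eq_pow]
  simp [isIntegral_one]

/-- If every nonzero element of the prime field is a `k`-th power, the eigenvalues of the
Paley graph are integers, congruent to the degree modulo the characteristic. -/
theorem exists_int_charSum_powers {p : ℕ} [Fact p.Prime] [CharP F p] {k n : ℕ} (hn : 0 < n)
    (hkn : Fintype.card F = k * n + 1) (hpn : p - 1 ∣ n) (ψ : AddChar F ℂ) (a : F) :
    ∃ z : ℤ, charSum ψ (powers k F) a = z ∧ (p : ℤ) ∣ z - n := by
  classical
  have hp : p.Prime := Fact.out
  have hmem : ∀ c ∈ Finset.Ico 1 p, (c : F) ∈ powers k F := by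
    intro c hc
    rw [Finset.mem_Ico] at hc
    rw [mem_powers_iff_pow_eq_one hn hkn]
    obtain ⟨t, rfl⟩ := hpn
    have : (c : ZMod p) ≠ 0 := by
      rw [Ne, ZMod.natCast_eq_zero_iff]
      exact Nat.not_dvd_of_pos_of_lt (by omega) hc.2
    have h1 := ZMod.pow_card_sub_one_eq_one this
    have h2 := congrArg (ZMod.castHom (dvd_refl p) F) h1
    rw [map_pow, map_natCast, map_one] at h2
    rw [pow_mul, h2, one_pow]
  set N := ((powers k F).filter fun s => ψ (a * s) = 1).card with hN
  -- Evaluate one double sum twice. Row by row, a nonzero `c` in the prime field permutes `R_k` and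
  -- reproduces the period; column by column, a `p`-th root of unity sums to `p` or `0`. Hence `(p -
  -- 1) * z = p * N - n`.
  have h1 : ∑ c ∈ range p, ∑ s ∈ powers k F, ψ (a * s) ^ c
      = n + (p - 1 : ℕ) * charSum ψ (powers k F) a := by
    rw [Finset.range_eq_Ico, Finset.sum_eq_sum_Ico_succ_bot hp.pos]
    have : ∀ c ∈ Finset.Ico (0 + 1) p, ∑ s ∈ powers k F, ψ (a * s) ^ c
        = charSum ψ (powers k F) a := by
      intro c hc
      rw [← charSum_powers_mul ψ (hmem c hc), charSum]
      refine Finset.sum_congr rfl fun s _ => ?_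
      rw [← AddChar.map_nsmul_eq_pow, nsmul_eq_mul, mul_assoc]
    rw [Finset.sum_congr rfl this]
    simp [card_powers hn hkn]
  have h2 : ∑ c ∈ range p, ∑ s ∈ powers k F, ψ (a * s) ^ c = p * N := by
    rw [Finset.sum_comm]
    have : ∀ s ∈ powers k F, ∑ c ∈ range p, ψ (a * s) ^ c
        = if ψ (a * s) = 1 then (p : ℂ) else 0 := by
      intro s _
      split_ifs with h
      · simp [h]
      · have hz : ψ (a * s) ^ p = 1 := by
          rw [← AddChar.map_nsmul_eq_pow]; simp
        rw [geom_sum_eq h, hz, sub_self, zero_div]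
    rw [Finset.sum_congr rfl this, ← Finset.sum_filter, Finset.sum_const, nsmul_eq_mul, mul_comm]
  have h3 : ((p - 1 : ℕ) : ℂ) * charSum ψ (powers k F) a = p * N - n := by
    rw [← h2, h1]; ring
  have hp1 : ((p - 1 : ℕ) : ℤ) ≠ 0 := by
    have := hp.two_le
    omega
  obtain ⟨z, hz⟩ := exists_int_eq_of_isIntegral_of_mul_eq
    (isIntegral_charSum (p := p) ψ (powers k F) a) (b := p * N - n) hp1 (by exact_mod_cast h3)
  refine ⟨z, hz, ?_⟩
  rw [hz] at h3
  have h4 : ((p - 1 : ℕ) : ℤ) * z = p * N - n := by exact_mod_cast h3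
  rw [Nat.cast_sub hp.one_le] at h4
  push_cast at h4
  exact ⟨z - N, by linarith⟩

end Integrality

/-! ### `powersCount` modulo `p`, through binomial coefficients. -/

section Counting

variable {F : Type*} [Field F] [Fintype F]

lemma sum_pow_eq_of_pos {i : ℕ} (hi : 0 < i) :
    ∑ x : F, x ^ i = if Fintype.card F - 1 ∣ i then -1 else 0 := by
  classical
  rw [← FiniteField.sum_pow_units]
  rw [← Finset.add_sum_erase univ _ (Finset.mem_univ 0), zero_pow hi.ne', zero_add]
  symm
  refine Finset.sum_bij (fun u _ => (u : F)) (by simp) (by simp [Units.ext_iff]) ?_ (by simp)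
  intro b hb
  exact ⟨Units.mk0 b (by simpa using hb), by simp⟩

/-- The power sum `∑ x ^ a * (1 - x) ^ b` over a finite field with `q` elements is minus the
coefficient of `x ^ (q - 1)`, when the exponents are not too large. -/
lemma sum_pow_mul_one_sub_pow {a b N : ℕ} (hN : Fintype.card F = N + 1) (ha : a ≤ N)
    (hab : a + b < 2 * N) :
    ∑ x : F, x ^ a * (1 - x) ^ b = - ((-1) ^ (N - a) * (b.choose (N - a) : F)) := by
  have h1 : ∀ x : F, x ^ a * (1 - x) ^ b
      = ∑ j ∈ range (b + 1), (-1) ^ j * (b.choose j : F) * x ^ (a + j) := by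
    intro x
    rw [sub_eq_add_neg, add_comm, add_pow, Finset.mul_sum]
    refine Finset.sum_congr rfl fun j _ => ?_
    rw [one_pow, mul_one, neg_pow, pow_add]
    ring
  simp_rw [h1]
  rw [Finset.sum_comm]
  simp_rw [← Finset.mul_sum]
  have hN0 : 0 < N := by
    have := Fintype.one_lt_card (α := F)
    omega
  have h2 : ∀ j ∈ range (b + 1), (-1) ^ j * (b.choose j : F) * ∑ x : F, x ^ (a + j)
      = if N - a = j then - ((-1) ^ (N - a) * (b.choose (N - a) : F)) else 0 := by
    intro j hj
    rw [Finset.mem_range] at hj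
    -- As `a + j < 2 * N`, a positive exponent divisible by `N` equals `N`; exponent `0` gives `q =
    -- 0` in `F`.
    have h3 : ∑ x : F, x ^ (a + j) = if N - a = j then -1 else 0 := by
      rcases Nat.eq_zero_or_pos (a + j) with h0 | h0
      · have : N - a ≠ j := by omega
        rw [h0, if_neg this]
        simp
      · rw [sum_pow_eq_of_pos h0, hN, Nat.add_sub_cancel]
        congr 1
        rw [eq_iff_iff]
        constructor
        · rintro ⟨c, hc⟩
          have : c = 1 := by
            have h4 : c < 2 := by
              by_contra! h
              have := Nat.mul_le_mul_left N h
              omega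
            have h5 : c ≠ 0 := by rintro rfl; omega
            omega
          subst this
          omega
        · intro h
          exact ⟨1, by omega⟩
    rw [h3]
    split_ifs with h
    · subst h; ring
    · simp
  rw [Finset.sum_congr rfl h2, Finset.sum_ite_eq]
  split_ifs with h
  · rfl
  · rw [Nat.choose_eq_zero_of_lt (by rw [Finset.mem_range] at h; omega)]
    simp

open Classical in
/-- The number of `s ∈ R_k` such that `1 - s ∈ R_k`. -/
noncomputable def powersCount (k : ℕ) (F : Type*) [Field F] [Fintype F] : ℕ :=
  ((powers k F).filter fun s => 1 - s ∈ powers k F).card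

/-- Here `x ^ n` is a `k`-th root of unity, equal to `1` exactly on `R_k`, so this is a geometric
sum detecting `R_k`. At `x = 0` the term `i = 0` still contributes `1`. -/
lemma sum_pow_mul_eq_ite {k n : ℕ} (hn : 0 < n) (hkn : Fintype.card F = k * n + 1) (hk : 0 < k)
    [DecidableEq F] (x : F) :
    ∑ i ∈ range k, x ^ (i * n) = if x = 0 then 1 else if x ∈ powers k F then (k : F) else 0 := by
  split_ifs with h0 h
  · subst h0
    obtain ⟨k, rfl⟩ := Nat.exists_eq_succ_of_ne_zero hk.ne'
    rw [Finset.sum_range_succ']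
    simp [hn.ne']
  · rw [mem_powers_iff_pow_eq_one hn hkn] at h
    simp [mul_comm _ n, pow_mul, h]
  · rw [mem_powers_iff_pow_eq_one hn hkn] at h
    simp_rw [mul_comm _ n, pow_mul]
    have := FiniteField.pow_card_sub_one_eq_one x h0
    rw [hkn, Nat.add_sub_cancel, mul_comm, pow_mul] at this
    rw [geom_sum_eq h, this, sub_self, zero_div]

/-- Expand the product of the detectors of `x` and `1 - x`; the points `x = 0` and `x = 1`
contribute `k` each. -/
lemma sq_mul_powersCount_add {k n : ℕ} (hn : 0 < n) (hkn : Fintype.card F = k * n + 1)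
    (hk : 0 < k) :
    (k : F) ^ 2 * powersCount k F + 2 * k
      = ∑ a ∈ range k, ∑ b ∈ range k, ∑ x : F, x ^ (a * n) * (1 - x) ^ (b * n) := by
  classical
  have h1 : ∑ a ∈ range k, ∑ b ∈ range k, ∑ x : F, x ^ (a * n) * (1 - x) ^ (b * n)
      = ∑ x : F, (∑ a ∈ range k, x ^ (a * n)) * (∑ b ∈ range k, (1 - x) ^ (b * n)) := by
    simp_rw [Finset.sum_mul_sum]
    symm
    rw [Finset.sum_comm]
    refine Finset.sum_congr rfl fun a _ => ?_
    rw [Finset.sum_comm]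
  rw [h1]
  simp_rw [sum_pow_mul_eq_ite hn hkn hk, sub_eq_zero]
  rw [← Finset.add_sum_erase univ _ (Finset.mem_univ (0 : F)),
    ← Finset.add_sum_erase (univ.erase 0) _
      (Finset.mem_erase.2 ⟨one_ne_zero, Finset.mem_univ (1 : F)⟩)]
  have h2 : ∀ x ∈ (univ.erase (0 : F)).erase 1,
      ((if x = 0 then 1 else if x ∈ powers k F then (k : F) else 0) *
        (if 1 = x then 1 else if 1 - x ∈ powers k F then (k : F) else 0))
      = if x ∈ powers k F ∧ 1 - x ∈ powers k F then (k : F) ^ 2 else 0 := by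
    intro x hx
    simp only [Finset.mem_erase, Finset.mem_univ, and_true] at hx
    rw [if_neg hx.2, if_neg (Ne.symm hx.1)]
    by_cases h3 : x ∈ powers k F <;> by_cases h4 : 1 - x ∈ powers k F <;> simp [h3, h4, pow_two]
  rw [Finset.sum_congr rfl h2, ← Finset.sum_filter, Finset.sum_const, nsmul_eq_mul]
  have h5 : (((univ.erase (0 : F)).erase 1).filter fun x => x ∈ powers k F ∧ 1 - x ∈ powers k F)
      = (powers k F).filter fun s => 1 - s ∈ powers k F := by
    ext x
    simp only [Finset.mem_filter, Finset.mem_erase, Finset.mem_univ, and_true]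
    constructor
    · exact fun h => h.2
    · rintro ⟨h, h'⟩
      refine ⟨⟨?_, ?_⟩, h, h'⟩
      · rintro rfl
        rw [sub_self] at h'
        exact zero_notMem_powers h'
      · rintro rfl
        exact zero_notMem_powers h
  rw [h5, powersCount]
  simp [one_mem_powers]
  ring

lemma sq_mul_powersCount_add_sum_choose {k n : ℕ} (hn : 0 < n)
    (hkn : Fintype.card F = k * n + 1) (hk : 0 < k) (heven : Even n) :
    (k : F) ^ 2 * powersCount k F + 2 * k
      + ∑ a ∈ range k, ∑ b ∈ range k, ((b * n).choose ((k - a) * n) : F) = 0 := by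
  rw [sq_mul_powersCount_add hn hkn hk, ← Finset.sum_add_distrib]
  refine Finset.sum_eq_zero fun a ha => ?_
  rw [← Finset.sum_add_distrib]
  refine Finset.sum_eq_zero fun b hb => ?_
  rw [Finset.mem_range] at ha hb
  rw [sum_pow_mul_one_sub_pow hkn (Nat.mul_le_mul_right n ha.le)
    (by rw [← add_mul, ← mul_assoc]; exact Nat.mul_lt_mul_of_pos_right (by omega) hn),
    ← Nat.sub_mul, Even.neg_one_pow (heven.mul_left _)]
  ring

/-- The surviving binomials are `1`, `1` and `(2 * n).choose n`; the constant is `8 = 2 * 3 + 2`. -/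
lemma three_powersCount {n : ℕ} (hn : 0 < n) (hkn : Fintype.card F = 3 * n + 1) (heven : Even n) :
    (9 : F) * powersCount 3 F + 8 + ((2 * n).choose n : F) = 0 := by
  rw [← sq_mul_powersCount_add_sum_choose hn hkn (by norm_num) heven]
  have h1 : n.choose (2 * n) = 0 := Nat.choose_eq_zero_of_lt (by omega)
  have h2 : n.choose (3 * n) = 0 := Nat.choose_eq_zero_of_lt (by omega)
  have h3 : (2 * n).choose (3 * n) = 0 := Nat.choose_eq_zero_of_lt (by omega)
  have h0 : ∀ j, 0 < j → Nat.choose 0 j = 0 := fun j => Nat.choose_eq_zero_of_lt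
  simp [Finset.sum_range_succ, h1, h2, h3, h0, hn]
  ring

/-- The substitution `x ↦ 1 - x` swaps the two exponents in the power sum; evaluating both orders
gives the two binomials modulo `p`. -/
lemma choose_three_mul_eq {n : ℕ} (hn : 0 < n) (hkn : Fintype.card F = 4 * n + 1)
    (heven : Even n) : ((3 * n).choose (2 * n) : F) = ((2 * n).choose n : F) := by
  have h1 := sum_pow_mul_one_sub_pow (a := 2 * n) (b := 3 * n) hkn (by omega) (by omega)
  have h2 := sum_pow_mul_one_sub_pow (a := 3 * n) (b := 2 * n) hkn (by omega) (by omega)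
  rw [← Equiv.sum_comp (Equiv.subLeft (1 : F))] at h1
  simp only [Equiv.subLeft_apply, sub_sub_cancel] at h1
  simp_rw [mul_comm ((1 - _ : F) ^ (2 * n))] at h1
  rw [h1, ← Nat.sub_mul, ← Nat.sub_mul, Even.neg_one_pow (heven.mul_left _),
    Even.neg_one_pow (heven.mul_left _)] at h2
  simpa using h2

lemma four_powersCount {n : ℕ} (hn : 0 < n) (hkn : Fintype.card F = 4 * n + 1) (heven : Even n) :
    (16 : F) * powersCount 4 F + 11 + 3 * ((2 * n).choose n : F) = 0 := by
  rw [← sq_mul_powersCount_add_sum_choose hn hkn (by norm_num) heven]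
  have h1 : n.choose (2 * n) = 0 := Nat.choose_eq_zero_of_lt (by omega)
  have h2 : n.choose (3 * n) = 0 := Nat.choose_eq_zero_of_lt (by omega)
  have h3 : (2 * n).choose (3 * n) = 0 := Nat.choose_eq_zero_of_lt (by omega)
  have h4 : n.choose (4 * n) = 0 := Nat.choose_eq_zero_of_lt (by omega)
  have h5 : (2 * n).choose (4 * n) = 0 := Nat.choose_eq_zero_of_lt (by omega)
  have h6 : (3 * n).choose (4 * n) = 0 := Nat.choose_eq_zero_of_lt (by omega)
  have h7 : (3 * n).choose n = (3 * n).choose (2 * n) := by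
    rw [← Nat.choose_symm (by omega : 2 * n ≤ 3 * n)]
    congr 1
    omega
  have h0 : ∀ j, 0 < j → Nat.choose 0 j = 0 := fun j => Nat.choose_eq_zero_of_lt
  simp [Finset.sum_range_succ, h0, h1, h2, h3, h4, h5, h6, h7, hn,
    choose_three_mul_eq hn hkn heven]
  ring

end Counting

/-! ### Non-divisibility of the central binomial coefficient. -/

section Binomial

/-- Kummer's theorem: every base `p` digit of `n = (p ^ m - 1) / k` is `(p - 1) / k ≤ (p - 1) / 2`,
so adding `n` to itself produces no carry. -/
lemma not_dvd_choose_two_mul {p m k n : ℕ} (hp : p.Prime) (hk : 2 ≤ k) (hpk : k ∣ p - 1)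
    (hkn : p ^ m = k * n + 1) : ¬ p ∣ (2 * n).choose n := by
  have hdvd : ∀ i, ∃ r, p ^ i = k * r + 1 := by
    intro i
    have h := hpk.trans (Nat.sub_one_dvd_pow_sub_one p i)
    obtain ⟨r, hr⟩ := h
    exact ⟨r, by have := Nat.pos_of_ne_zero (pow_ne_zero i hp.ne_zero); omega⟩
  have hf : ((n + n).choose n).factorization p = 0 := by
    rw [Nat.factorization_choose' hp (Nat.lt_succ_self _), Finset.card_eq_zero,
      Finset.filter_eq_empty_iff]
    intro i _
    rw [not_le]
    rcases le_or_gt i m with him | him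
    · obtain ⟨r, hr⟩ := hdvd i
      obtain ⟨t, ht⟩ := hdvd (m - i)
      -- So `n` modulo `p ^ i` is `r = (p ^ i - 1) / k`, and `2 * r < p ^ i`.
      have hnr : n = r + p ^ i * t := by
        have h1 : p ^ m = p ^ i * p ^ (m - i) := by rw [← pow_add, Nat.add_sub_cancel' him]
        have h2 : k * n = k * (r + p ^ i * t) := by
          rw [hkn, ht] at h1
          have : k * n + 1 = k * (r + p ^ i * t) + 1 := by
            rw [h1]
            linear_combination hr
          omega
        exact Nat.eq_of_mul_eq_mul_left (by omega) h2
      have hrlt : 2 * r ≤ k * r := Nat.mul_le_mul_right r hk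
      rw [hnr, Nat.add_mul_mod_self_left, Nat.mod_eq_of_lt (by omega)]
      omega
    · have h1 : p ^ m ≤ p ^ i := Nat.pow_le_pow_right hp.pos him.le
      have h2 : 2 * n ≤ k * n := Nat.mul_le_mul_right n hk
      rw [Nat.mod_eq_of_lt (by omega)]
      omega
  rw [two_mul]
  intro h
  have := (hp.dvd_iff_one_le_factorization (Nat.choose_pos (Nat.le_add_left n n)).ne').1 h
  omega

end Binomial

/-! ### Power moments of the periods. -/

section Moments

variable {F : Type*} [Field F] [Fintype F]

lemma neg_mem_powers {k n : ℕ} (hn : 0 < n) (hkn : Fintype.card F = k * n + 1) (heven : Even n)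
    {s : F} (hs : s ∈ powers k F) : -s ∈ powers k F := by
  rw [mem_powers_iff_pow_eq_one hn hkn] at *
  rw [heven.neg_pow, hs]

variable {k n : ℕ} {g : F} {ψ : AddChar F ℂ} {η : ℕ → ℤ}

lemma sum_periods (hn : 0 < n)
    (hkn : Fintype.card F = k * n + 1) (hg : IsPrimitiveRoot g (k * n)) (hψ : ψ.IsPrimitive)
    (hη : ∀ i, charSum ψ (powers k F) (g ^ i) = η i) : ∑ i ∈ range k, η i = -1 := by
  have h := sum_comp_charSum hn hkn hg ψ (fun z => z)
  rw [sum_charSum hψ zero_notMem_powers] at h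
  simp_rw [hη, nsmul_eq_mul] at h
  have h' : (0 : ℤ) = n + n * ∑ i ∈ range k, η i := by exact_mod_cast h
  have hn' : (n : ℤ) ≠ 0 := by omega
  apply mul_left_cancel₀ hn'
  linarith

lemma sum_periods_sq (hn : 0 < n)
    (hkn : Fintype.card F = k * n + 1) (hg : IsPrimitiveRoot g (k * n)) (heven : Even n)
    (hψ : ψ.IsPrimitive) (hη : ∀ i, charSum ψ (powers k F) (g ^ i) = η i) :
    ∑ i ∈ range k, η i ^ 2 = k * n + 1 - n := by
  have h := sum_comp_charSum hn hkn hg ψ (fun z => z ^ 2)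
  rw [sum_charSum_sq hψ fun s hs => neg_mem_powers hn hkn heven hs, card_powers hn hkn, hkn] at h
  simp_rw [hη, nsmul_eq_mul] at h
  have h' : (k * n + 1 : ℤ) * n = n ^ 2 + n * ∑ i ∈ range k, η i ^ 2 := by exact_mod_cast h
  have hn' : (n : ℤ) ≠ 0 := by omega
  apply mul_left_cancel₀ hn'
  linarith

lemma sum_periods_cube (hn : 0 < n)
    (hkn : Fintype.card F = k * n + 1) (hg : IsPrimitiveRoot g (k * n)) (heven : Even n)
    (hψ : ψ.IsPrimitive) (hη : ∀ i, charSum ψ (powers k F) (g ^ i) = η i) :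
    ∑ i ∈ range k, η i ^ 3 = (k * n + 1) * powersCount k F - n ^ 2 := by
  have h := sum_comp_charSum hn hkn hg ψ (fun z => z ^ 3)
  rw [sum_charSum_cube hψ (fun s hs => neg_mem_powers hn hkn heven hs) zero_notMem_powers
    (fun r hr x => mul_mem_powers_iff hr x), card_powers hn hkn, hkn] at h
  simp_rw [hη, nsmul_eq_mul] at h
  have h' : (k * n + 1 : ℤ) * n * powersCount k F = n ^ 3 + n * ∑ i ∈ range k, η i ^ 3 := by
    unfold powersCount
    exact_mod_cast h
  have hn' : (n : ℤ) ≠ 0 := by omega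
  apply mul_left_cancel₀ hn'
  linarith

/-- The squares split as `R_4 ∪ g ^ 2 * R_4`, according to the parity of the exponent. -/
lemma charSum_powers_two {n : ℕ} (hn : 0 < n) (hkn : Fintype.card F = 4 * n + 1) {g : F}
    (hg : IsPrimitiveRoot g (4 * n)) (ψ : AddChar F ℂ) (i : ℕ) :
    charSum ψ (powers 2 F) (g ^ i)
      = charSum ψ (powers 4 F) (g ^ i) + charSum ψ (powers 4 F) (g ^ (i + 2)) := by
  have h2 : 4 * n = 2 * (2 * n) := by ring
  unfold charSum
  rw [sum_powers hn hkn hg, sum_powers hn hkn hg, sum_powers (n := 2 * n) (by omega)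
    (by rw [hkn, h2]) (by rwa [← h2]), ← Finset.sum_add_distrib]
  have h3 : ∀ (f : ℕ → ℂ) (n : ℕ), ∑ l ∈ range (2 * n), f l
      = ∑ l ∈ range n, (f (2 * l) + f (2 * l + 1)) := by
    intro f n
    induction n with
    | zero => simp
    | succ n ih => rw [Nat.mul_succ, Finset.sum_range_succ, Finset.sum_range_succ, ih,
        Finset.sum_range_succ, add_assoc]
  rw [h3]
  refine Finset.sum_congr rfl fun l _ => ?_
  congr 2 <;> ring

/-- The quadratic periods `η 0 + η 2` and `η 1 + η 3` have sum `-1` and sum of squares `2 * n + 1`;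
eliminate the second. -/
lemma sq_periods_eq (hn : 0 < n) (hkn : Fintype.card F = 4 * n + 1) (hg : IsPrimitiveRoot g (4 * n))
    (hψ : ψ.IsPrimitive)
    (hη : ∀ i, charSum ψ (powers 4 F) (g ^ i) = η i) :
    (2 * (η 0 + η 2) + 1) ^ 2 = (4 * n + 1 : ℤ) := by
  have h2 : 4 * n = 2 * (2 * n) := by ring
  have hθ : ∀ i, charSum ψ (powers 2 F) (g ^ i) = (η i + η (i + 2) : ℤ) := by
    intro i
    rw [charSum_powers_two hn hkn hg, hη, hη]
    push_cast; rfl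
  have e1 := sum_periods (η := fun i => η i + η (i + 2)) (n := 2 * n) (by omega) (by rw [hkn, h2])
    (by rwa [← h2]) hψ hθ
  have e2 := sum_periods_sq (η := fun i => η i + η (i + 2)) (n := 2 * n) (by omega)
    (by rw [hkn, h2]) (by rwa [← h2]) (even_two_mul n) hψ hθ
  simp only [Finset.sum_range_succ, Finset.sum_range_zero] at e1 e2
  push_cast at e2
  norm_num at e1 e2
  have e3 : η 1 + η 3 = -1 - (η 0 + η 2) := by linarith
  rw [e3] at e2
  linarith

end Moments

/-! ### Integer constraints on coinciding periods. -/

section Separation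

/-- The first two moments give `(3 * a + 1) ^ 2 = q`, so `p ∣ 3 * a + 1`; the third, divided by `q`,
writes `9 * T + 8` as a combination of `3 * a + 1` and `q`. -/
lemma three_periods_ne {p n T a b : ℤ} (hp : Prime p) (hq : p ∣ 3 * n + 1)
    (hT : ¬ p ∣ 9 * T + 8) (h1 : 2 * a + b = -1) (h2 : 2 * a ^ 2 + b ^ 2 = 3 * n + 1 - n)
    (h3 : 2 * a ^ 3 + b ^ 3 = (3 * n + 1) * T - n ^ 2) : False := by
  obtain rfl : b = -1 - 2 * a := by linarith
  have hx : (3 * a + 1) ^ 2 = 3 * n + 1 := by linarith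
  have hpx : p ∣ 3 * a + 1 := hp.dvd_of_dvd_pow (hx ▸ hq)
  have hq0 : 3 * n + 1 ≠ 0 := by omega
  have h4 : -2 * (3 * a + 1) + (3 * n + 1) = 9 * T + 8 := by
    apply mul_left_cancel₀ hq0
    linear_combination 9 * h3 + (2 * (3 * a + 1) + 6) * hx
  exact hT (h4 ▸ dvd_add (hpx.mul_left _) hq)

lemma four_periods_ne {p n T a b : ℤ} (hp : Prime p) (hq : p ∣ 4 * n + 1)
    (hT : ¬ p ∣ 16 * T + 11) (h1 : 3 * a + b = -1) (h2 : 3 * a ^ 2 + b ^ 2 = 4 * n + 1 - n)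
    (h3 : 3 * a ^ 3 + b ^ 3 = (4 * n + 1) * T - n ^ 2) : False := by
  obtain rfl : b = -1 - 3 * a := by linarith
  have hx : (4 * a + 1) ^ 2 = 4 * n + 1 := by linarith
  have hpx : p ∣ 4 * a + 1 := hp.dvd_of_dvd_pow (hx ▸ hq)
  have hq0 : 4 * n + 1 ≠ 0 := by omega
  have h4 : -6 * (4 * a + 1) + (4 * n + 1) = 16 * T + 11 := by
    apply mul_left_cancel₀ hq0
    linear_combination 16 * h3 + (6 * (4 * a + 1) + 9) * hx
  exact hT (h4 ▸ dvd_add (hpx.mul_left _) hq)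

/-- If the positive numbers among `a, b, c, d` coincide, either exactly one of `a`, `c` is the
only positive number, or three of the numbers coincide. -/
lemma four_periods_cases {n a b c d : ℤ} (h1 : a + b + c + d = -1)
    (h2 : a ^ 2 + b ^ 2 + c ^ 2 + d ^ 2 = 3 * n + 1) (hy : (2 * (a + c) + 1) ^ 2 = 4 * n + 1)
    (hac : 0 ≤ a + c) (ha : a ≠ 0) (hb : b ≠ 0) (hc : c ≠ 0) (hd : d ≠ 0)
    (eac : 0 < a → 0 < c → a = c) (eab : 0 < a → 0 < b → a = b) (ead : 0 < a → 0 < d → a = d)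
    (ecb : 0 < c → 0 < b → c = b) (ecd : 0 < c → 0 < d → c = d) :
    (0 < a ∧ b < 0 ∧ c < 0 ∧ d < 0) ∨ (0 < c ∧ a < 0 ∧ b < 0 ∧ d < 0) ∨
      (a = c ∧ a = b) ∨ (a = c ∧ a = d) := by
  -- Twice the second moment minus `(a + c) ^ 2 + (b + d) ^ 2 = 2 * n + 1` leaves `4 * n + 1`.
  have key : (a - c) ^ 2 + (b - d) ^ 2 = (2 * (a + c) + 1) ^ 2 := by
    have : d = -1 - a - b - c := by linarith
    subst this
    nlinarith
  -- If `a = b`, then `b - d = 3 * a + c + 1` exceeds `2 * (a + c) + 1 > 0`, as `c < a`,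
  -- contradicting `key`.
  have main : ∀ a c b d : ℤ, a + b + c + d = -1 →
      (a - c) ^ 2 + (b - d) ^ 2 = (2 * (a + c) + 1) ^ 2 → 0 ≤ a + c → 0 < a → c < 0 →
      a ≠ b := by
    rintro a c b d h1 key hac ha hc rfl
    have : d = -1 - 2 * a - c := by linarith
    subst this
    nlinarith
  rcases lt_or_gt_of_ne ha with ha' | ha'
  · have hc' : 0 < c := by omega
    have hb' : b < 0 := by
      by_contra! h
      have := ecb hc' (by omega)
      exact main c a b d (by linarith) (by linarith) (by linarith) hc' ha' this
    have hd' : d < 0 := by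
      by_contra! h
      have := ecd hc' (by omega)
      exact main c a d b (by linarith) (by linarith) (by linarith) hc' ha' this
    omega
  · rcases lt_or_gt_of_ne hc with hc' | hc'
    · have hb' : b < 0 := by
        by_contra! h
        have := eab ha' (by omega)
        exact main a c b d (by linarith) (by linarith) (by linarith) ha' hc' this
      have hd' : d < 0 := by
        by_contra! h
        have := ead ha' (by omega)
        exact main a c d b (by linarith) (by linarith) (by linarith) ha' hc' this
      omega
    · obtain rfl := eac ha' hc'
      -- Now `b - d = ±(4 * a + 1)` and `b + d = -1 - 2 * a`, so `b = a` or `d = a`.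
      have : (b - d) ^ 2 = (2 * (a + a) + 1) ^ 2 := by linarith
      rcases sq_eq_sq_iff_eq_or_eq_neg.1 this with h | h
      · right; right; left; constructor <;> omega
      · right; right; right; constructor <;> omega

end Separation

/-! ### Congruences forced by the hypotheses. -/

section Arithmetic

/-- The arithmetic consequences of `k ∣ (q - 1) / (p - 1)` and non-semiprimitivity. -/
lemma arithmetic_of_not_isSemiprimitivePair {p m k : ℕ} (hp : p.Prime) (hm : 0 < m)
    (hk : k = 3 ∨ k = 4) (hdvd : k ∣ (p ^ m - 1) / (p - 1))
    (hsp : ¬ IsSemiprimitivePair k (p ^ m)) :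
    ∃ n, p ^ m = k * n + 1 ∧ k ≤ n ∧ Even n ∧ p - 1 ∣ n ∧ k ∣ p - 1 := by
  obtain ⟨t, ht⟩ := hdvd
  -- The exponent `1` suffices: the units modulo `3` and `4` are `±1`, so excluding `-1` leaves `p ≡
  -- 1`.
  have h1 : ¬ k ∣ p + 1 := fun h => hsp ⟨p, m, 1, hp, hm, rfl, by simpa using h⟩
  have h2 := Nat.div_mul_cancel (Nat.sub_one_dvd_pow_sub_one p m)
  have hp2 := hp.two_le
  have hq : 1 < p ^ m := Nat.one_lt_pow hm.ne' hp.one_lt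
  have hqn : p ^ m = k * ((p - 1) * t) + 1 := by
    rw [ht] at h2
    have : k * ((p - 1) * t) = k * t * (p - 1) := by ring
    omega
  have hpq : p ∣ k * ((p - 1) * t) + 1 := hqn ▸ dvd_pow_self p hm.ne'
  have hpk : ¬ p ∣ k := by
    intro h
    have := (Nat.dvd_add_right (h.mul_right ((p - 1) * t))).1 hpq
    exact hp.one_lt.ne' (Nat.dvd_one.1 this)
  have ht0 : 0 < t := by
    rcases Nat.eq_zero_or_pos t with rfl | h
    · simp at hqn; omega
    · exact h
  have hodd : p ≠ 2 := by
    rintro rfl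
    rcases hk with rfl | rfl
    · exact h1 (by norm_num)
    · exact hpk (by norm_num)
  have hodd' := hp.eq_two_or_odd.resolve_left hodd
  have hkp : k ∣ p - 1 := by
    rcases hk with rfl | rfl
    · have h3 : ¬ 3 ∣ p := fun h => hpk (by rw [(Nat.prime_dvd_prime_iff_eq Nat.prime_three hp).1 h])
      have h4 : p % 3 = 0 ∨ p % 3 = 1 ∨ p % 3 = 2 := by omega
      rcases h4 with h4 | h4 | h4 <;> omega
    · omega
  refine ⟨(p - 1) * t, hqn, ?_, ?_, Dvd.intro _ rfl, hkp⟩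
  · calc k ≤ p - 1 := Nat.le_of_dvd (by omega) hkp
      _ ≤ (p - 1) * t := Nat.le_mul_of_pos_right _ ht0
  · exact Even.mul_right (by rw [Nat.even_iff]; omega) t

end Arithmetic

/-! ### Spectrum, energy and separation for generalized Paley graphs. -/

section PaleyGraph

variable {F : Type*} [Field F] [Fintype F]

lemma sum_spec_gpGraph (k : ℕ) : (spec (gpGraph k F)).sum = 0 := by
  refine sum_spec_of_loopless fun v => ?_
  simp [gpGraph_eq, cayleyGraph, zero_notMem_powers]

lemma sum_spec_complement {V : Type*} [Fintype V] (Γ : Digraph V) :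
    (spec (complement Γ)).sum = 0 :=
  sum_spec_of_loopless fun v => by simp [complement]

/-- The multiplicative data of the generalized Paley graph `Γ(k, q)` together with its integral
eigenvalues `η i`, one for each coset `g ^ i * R_k` with `i < k`. -/
structure PaleyPeriods (k n : ℕ) (F : Type*) [Field F] [Fintype F] where
  ψ : AddChar F ℂ
  primitive : ψ.IsPrimitive
  g : F
  generator : IsPrimitiveRoot g (k * n)
  η : ℕ → ℤ
  charSum_eq : ∀ i, charSum ψ (powers k F) (g ^ i) = η i
  k_le : k ≤ n
  two_lt : 2 < k
  card_eq : Fintype.card F = k * n + 1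
  even : Even n

namespace PaleyPeriods

variable {k n : ℕ}

lemma pos (P : PaleyPeriods k n F) : 0 < n := by
  have := P.k_le
  have := P.two_lt
  omega

lemma neg_mem_iff (P : PaleyPeriods k n F) (s : F) : -s ∈ powers k F ↔ s ∈ powers k F :=
  ⟨fun h => by simpa using neg_mem_powers P.pos P.card_eq P.even h,
    neg_mem_powers P.pos P.card_eq P.even⟩

lemma spec_gpGraph (P : PaleyPeriods k n F) :
    spec (gpGraph k F) = univ.val.map (charSum P.ψ (powers k F)) := by
  rw [gpGraph_eq, spec_cayleyGraph P.primitive]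

open Classical in
lemma spec_complement (P : PaleyPeriods k n F) :
    spec (complement (gpGraph k F))
      = univ.val.map (charSum P.ψ ((powers k F)ᶜ.erase 0)) := by
  rw [gpGraph_eq, complement_cayleyGraph, spec_cayleyGraph P.primitive]

lemma energy_gpGraph (P : PaleyPeriods k n F) :
    energy (gpGraph k F) = n + n * ∑ i ∈ range k, |(P.η i : ℝ)| := by
  rw [energy, P.spec_gpGraph, Multiset.map_map]
  change ∑ a, ‖charSum P.ψ (powers k F) a‖ = _
  rw [sum_comp_charSum P.pos P.card_eq P.generator P.ψ (fun z => ‖z‖)]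
  simp [P.charSum_eq]

lemma energy_complement (P : PaleyPeriods k n F) : energy (complement (gpGraph k F))
    = (k * n - n) + n * ∑ i ∈ range k, |(1 + P.η i : ℝ)| := by
  classical
  have hk := P.two_lt
  rw [energy, P.spec_complement, Multiset.map_map]
  change ∑ a, ‖charSum P.ψ ((powers k F)ᶜ.erase 0) a‖ = _
  -- Away from `0` the complement has eigenvalue `-1 - η`; only the term at `0` must be exchanged,
  -- for `(k - 1) * n`.
  have h := sum_comp_charSum P.pos P.card_eq P.generator P.ψ (fun z => ‖1 + z‖)
  rw [← Finset.add_sum_erase univ _ (Finset.mem_univ (0 : F))] at h ⊢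
  have h1 : ∀ a ∈ univ.erase (0 : F), ‖charSum P.ψ ((powers k F)ᶜ.erase 0) a‖
      = ‖1 + charSum P.ψ (powers k F) a‖ := by
    intro a ha
    rw [charSum_compl P.primitive zero_notMem_powers, if_neg (Finset.ne_of_mem_erase ha), ← norm_neg]
    congr 1; ring
  have h2 : charSum P.ψ ((powers k F)ᶜ.erase 0) 0 = ((k - 1 : ℕ) * n : ℕ) := by
    rw [charSum_compl P.primitive zero_notMem_powers, charSum_zero, card_powers P.pos P.card_eq,
      if_pos rfl, P.card_eq]
    push_cast [Nat.cast_sub (by omega : 1 ≤ k)]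
    ring
  rw [Finset.sum_congr rfl h1, h2, Complex.norm_natCast]
  have h3 : ‖1 + charSum P.ψ (powers k F) 0‖ = 1 + n := by
    rw [charSum_zero, card_powers P.pos P.card_eq]
    exact_mod_cast Complex.norm_natCast (1 + n)
  have h4 : ‖(1 : ℂ) + n‖ = 1 + n := by
    exact_mod_cast Complex.norm_natCast (1 + n)
  rw [h3, h4] at h
  rw [add_left_cancel h]
  have h5 : ∀ i, ‖1 + charSum P.ψ (powers k F) (P.g ^ i)‖ = |(1 + P.η i : ℝ)| := by
    intro i
    rw [P.charSum_eq, ← Real.norm_eq_abs, ← Complex.norm_real]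
    push_cast; rfl
  simp_rw [h5]
  push_cast [Nat.cast_sub (by omega : 1 ≤ k)]
  rw [nsmul_eq_mul]
  ring

/-- `Γ(k, q)` and its complement are equienergetic exactly when a single coset carries a
nonnegative eigenvalue. -/
lemma equienergetic_complement_iff (P : PaleyPeriods k n F) :
    Equienergetic (gpGraph k F) (complement (gpGraph k F))
      ↔ ((range k).filter fun i => 0 ≤ P.η i).card = 1 := by
  -- Integrality matters: a negative period is at most `-1`.
  have h1 : ∀ i, |(1 + P.η i : ℝ)| = |(P.η i : ℝ)| + (2 * (if 0 ≤ P.η i then 1 else 0) - 1) := by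
    intro i
    split_ifs with h
    · have h' : (0 : ℝ) ≤ P.η i := by exact_mod_cast h
      rw [abs_of_nonneg h', abs_of_nonneg (by linarith)]
      ring
    · have h' : (P.η i : ℝ) ≤ -1 := by exact_mod_cast (by omega : P.η i ≤ -1)
      rw [abs_of_nonpos (by linarith), abs_of_nonpos (by linarith)]
      ring
  have hn : (0 : ℝ) < n := by exact_mod_cast P.pos
  rw [Equienergetic, P.energy_gpGraph, P.energy_complement]
  simp_rw [h1]
  rw [Finset.sum_add_distrib, Finset.sum_sub_distrib, ← Finset.mul_sum, Finset.sum_boole]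
  simp only [true_and, Finset.sum_const, Finset.card_range, nsmul_eq_mul, mul_one]
  rw [← Nat.cast_inj (R := ℝ), Nat.cast_one]
  constructor
  · intro h
    apply mul_left_cancel₀ hn.ne'
    linarith
  · intro h
    rw [h]
    ring

lemma sum_eq (P : PaleyPeriods k n F) : ∑ i ∈ range k, P.η i = -1 :=
  sum_periods P.pos P.card_eq P.generator P.primitive P.charSum_eq

lemma sum_sq_eq (P : PaleyPeriods k n F) : ∑ i ∈ range k, P.η i ^ 2 = k * n + 1 - n :=
  sum_periods_sq P.pos P.card_eq P.generator P.even P.primitive P.charSum_eq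

lemma sum_cube_eq (P : PaleyPeriods k n F) :
    ∑ i ∈ range k, P.η i ^ 3 = (k * n + 1) * powersCount k F - n ^ 2 :=
  sum_periods_cube P.pos P.card_eq P.generator P.even P.primitive P.charSum_eq

/-- The nontrivial eigenvalues are smaller than the degree. -/
lemma lt_degree (P : PaleyPeriods k n F) {i : ℕ} (hi : i < k) : P.η i < n := by
  by_contra! h
  have h1 : P.η i ^ 2 ≤ k * n + 1 - n := by
    rw [← P.sum_sq_eq]
    exact Finset.single_le_sum (f := fun i => P.η i ^ 2) (fun j _ => sq_nonneg _)
      (Finset.mem_range.2 hi)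
  have h2 : (k : ℤ) ≤ n := by exact_mod_cast P.k_le
  have h3 : (2 : ℤ) < k := by exact_mod_cast P.two_lt
  nlinarith

lemma mem_spec_iff (P : PaleyPeriods k n F) (z : ℂ) :
    z ∈ spec (gpGraph k F) ↔ z = n ∨ ∃ i < k, z = P.η i := by
  have hkn : k * n ≠ 0 := by
    have := P.pos
    have := P.two_lt
    positivity
  rw [P.spec_gpGraph, Multiset.mem_map]
  constructor
  · rintro ⟨a, -, rfl⟩
    by_cases ha : a = 0
    · left
      rw [ha, charSum_zero, card_powers P.pos P.card_eq]
    · right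
      obtain ⟨j, -, rfl⟩ := exists_pow_generator P.card_eq P.generator ha
      refine ⟨j % k, Nat.mod_lt _ (by have := P.two_lt; omega), ?_⟩
      rw [← P.charSum_eq, ← Nat.div_add_mod j k, pow_add, charSum_powers_mul]
      · simp
      · exact mem_powers.2 ⟨P.g ^ (j / k), pow_ne_zero _ (P.generator.ne_zero hkn),
          by rw [← pow_mul, mul_comm]⟩
  · rintro (rfl | ⟨i, -, rfl⟩)
    · exact ⟨0, by simp, by rw [charSum_zero, card_powers P.pos P.card_eq]⟩
    · exact ⟨P.g ^ i, by simp, P.charSum_eq i⟩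

lemma isRegular_iff (P : PaleyPeriods k n F) (d : ℕ) : IsRegular (gpGraph k F) d ↔ d = n := by
  have h : ∀ v : F, {w | (gpGraph k F).Adj v w}.ncard = n := by
    intro v
    rw [← card_powers P.pos P.card_eq, ← Set.ncard_coe_finset,
      ← Set.ncard_image_of_injective (powers k F : Set F) (add_left_injective v)]
    congr 1
    ext w
    simp [gpGraph_eq, cayleyGraph, ← sub_eq_add_neg]
  constructor
  · intro hd
    rw [← hd 0, h]
  · rintro rfl v
    exact h v

lemma isNonPrincipalEigenvalue_iff (P : PaleyPeriods k n F) (x : ℝ) :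
    IsNonPrincipalEigenvalue (gpGraph k F) x ↔ ∃ i < k, x = P.η i := by
  rw [IsNonPrincipalEigenvalue, P.mem_spec_iff]
  simp only [P.isRegular_iff, forall_eq]
  constructor
  · rintro ⟨h | ⟨i, hi, h⟩, hx⟩
    · exact absurd (by exact_mod_cast h) hx
    · exact ⟨i, hi, by exact_mod_cast h⟩
  · rintro ⟨i, hi, rfl⟩
    refine ⟨Or.inr ⟨i, hi, by simp⟩, ?_⟩
    have := P.lt_degree hi
    exact_mod_cast this.ne

lemma equienergetic_sumGraph (P : PaleyPeriods k n F) :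
    Equienergetic (gpGraph k F) (gpSumGraph k F) := by
  refine ⟨rfl, ?_⟩
  refine energy_cayleyGraph_eq_energy_cayleySumGraph fun s => ?_
  have := P.neg_mem_iff s
  rwa [mem_powers, mem_powers] at this

lemma two_ne_zero (P : PaleyPeriods k n F) : (2 : F) ≠ 0 := by
  have h1 : ((k * n + 1 : ℕ) : F) = 0 := by rw [← P.card_eq]; simp
  obtain ⟨t, rfl⟩ := P.even
  intro h2
  push_cast at h1
  rw [← two_mul, h2] at h1
  simp at h1

/-- The trace counts loops, and `2⁻¹` carries one because `1 ∈ R_k`. -/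
lemma sum_spec_sumGraph_ne_zero (P : PaleyPeriods k n F) : (spec (gpSumGraph k F)).sum ≠ 0 := by
  classical
  rw [sum_spec, Matrix.trace]
  simp only [adjacencyMatrix, Matrix.diag_apply, Matrix.of_apply, Finset.sum_boole]
  rw [Nat.cast_ne_zero, Finset.card_ne_zero]
  refine ⟨2⁻¹, Finset.mem_filter.2 ⟨Finset.mem_univ _, 1, one_ne_zero, ?_⟩⟩
  rw [one_pow, ← two_mul, mul_inv_cancel₀ P.two_ne_zero]

/-- The complement has the eigenvalue `(k - 1) * n`, larger than every eigenvalue of `Γ(k, q)`. -/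
lemma not_isospectral_complement (P : PaleyPeriods k n F) :
    ¬ Isospectral (gpGraph k F) (complement (gpGraph k F)) := by
  classical
  intro h
  have h3 : (2 : ℤ) < k := by exact_mod_cast P.two_lt
  have hn : (0 : ℤ) < n := by exact_mod_cast P.pos
  have h1 : (((k * n - n : ℤ)) : ℂ) ∈ spec (complement (gpGraph k F)) := by
    rw [P.spec_complement, Multiset.mem_map]
    refine ⟨0, by simp, ?_⟩
    rw [charSum_compl P.primitive zero_notMem_powers, charSum_zero, card_powers P.pos P.card_eq,
      if_pos rfl, P.card_eq]
    push_cast; ring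
  rw [← h, P.mem_spec_iff] at h1
  rcases h1 with h1 | ⟨i, hi, h1⟩
  · have h2 : (k * n - n : ℤ) = n := by exact_mod_cast h1
    nlinarith
  · have h2 : (k * n - n : ℤ) = P.η i := by exact_mod_cast h1
    have := P.lt_degree hi
    nlinarith

/-- The criterion for equienergeticity, provided a positive eigenvalue shared by all cosets with
positive eigenvalues comes from a single coset. -/
lemma equienergetic_complement_iff_existsUnique (P : PaleyPeriods k n F) (h0 : ∀ i, P.η i ≠ 0)
    (hsep : ∀ i < k, 0 < P.η i → (∀ j < k, 0 < P.η j → P.η j = P.η i) →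
      ∀ j < k, 0 < P.η j → j = i) :
    Equienergetic (gpGraph k F) (complement (gpGraph k F)) ↔
      ∃! x : ℝ, IsNonPrincipalEigenvalue (gpGraph k F) x ∧ 0 < x := by
  rw [P.equienergetic_complement_iff, Finset.card_eq_one]
  simp_rw [P.isNonPrincipalEigenvalue_iff]
  have hpos : ∀ i, 0 ≤ P.η i ↔ 0 < P.η i := fun i =>
    ⟨fun h => lt_of_le_of_ne h (h0 i).symm, le_of_lt⟩
  simp_rw [hpos]
  constructor
  · rintro ⟨i, hi⟩
    have hmem : ∀ j, j < k ∧ 0 < P.η j ↔ j = i := fun j => by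
      rw [← Finset.mem_singleton, ← hi, Finset.mem_filter, Finset.mem_range]
    obtain ⟨hik, hi0⟩ := (hmem i).2 rfl
    refine ⟨P.η i, ⟨⟨i, hik, rfl⟩, by exact_mod_cast hi0⟩, ?_⟩
    rintro x ⟨⟨j, hj, rfl⟩, hx⟩
    rw [(hmem j).1 ⟨hj, by exact_mod_cast hx⟩]
  · rintro ⟨x, ⟨⟨i, hi, rfl⟩, hx⟩, hu⟩
    have hx' : 0 < P.η i := by exact_mod_cast hx
    refine ⟨i, ?_⟩
    ext j
    rw [Finset.mem_filter, Finset.mem_range, Finset.mem_singleton]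
    constructor
    · rintro ⟨hj, hj0⟩
      refine hsep i hi hx' (fun l hl hl0 => ?_) j hj hj0
      exact_mod_cast hu (P.η l) ⟨⟨l, hl, rfl⟩, by exact_mod_cast hl0⟩
    · rintro rfl
      exact ⟨hi, hx'⟩

end PaleyPeriods

/-- For `k = 3` the eigenvalues on distinct cosets are distinct. -/
lemma PaleyPeriods.three_injective {n : ℕ} (P : PaleyPeriods 3 n F) {p : ℤ} (hp : Prime p)
    (hq : p ∣ 3 * n + 1) (hT : ¬ p ∣ 9 * powersCount 3 F + 8) :
    P.η 0 ≠ P.η 1 ∧ P.η 0 ≠ P.η 2 ∧ P.η 1 ≠ P.η 2 := by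
  have h1 := P.sum_eq
  have h2 := P.sum_sq_eq
  have h3 := P.sum_cube_eq
  simp only [Finset.sum_range_succ, Finset.sum_range_zero, zero_add] at h1 h2 h3
  push_cast at h2 h3
  refine ⟨fun h => ?_, fun h => ?_, fun h => ?_⟩ <;> rw [h] at h1 h2 h3
  · exact three_periods_ne hp hq hT (a := P.η 1) (b := P.η 2) (by linarith) (by linarith)
      (by linarith)
  · exact three_periods_ne hp hq hT (a := P.η 2) (b := P.η 1) (by linarith) (by linarith)
      (by linarith)
  · exact three_periods_ne hp hq hT (a := P.η 2) (b := P.η 0) (by linarith) (by linarith)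
      (by linarith)

lemma PaleyPeriods.three_separated {n : ℕ} (P : PaleyPeriods 3 n F) {p : ℤ} (hp : Prime p)
    (hq : p ∣ 3 * n + 1) (hT : ¬ p ∣ 9 * powersCount 3 F + 8) :
    ∀ i < 3, 0 < P.η i → (∀ j < 3, 0 < P.η j → P.η j = P.η i) →
      ∀ j < 3, 0 < P.η j → j = i := by
  obtain ⟨h1, h2, h3⟩ := P.three_injective hp hq hT
  intro i hi _ h j hj hj0
  have := h j hj hj0
  interval_cases i <;> interval_cases j <;> first | rfl | omega

/-- For `k = 4` no three cosets carry the same eigenvalue. -/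
lemma PaleyPeriods.four_separated {n : ℕ} (P : PaleyPeriods 4 n F) {p : ℤ} (hp : Prime p)
    (hq : p ∣ 4 * n + 1) (hT : ¬ p ∣ 16 * powersCount 4 F + 11) (h0 : ∀ i, P.η i ≠ 0) :
    ∀ i < 4, 0 < P.η i → (∀ j < 4, 0 < P.η j → P.η j = P.η i) →
      ∀ j < 4, 0 < P.η j → j = i := by
  intro i hi hi0 h
  have h1 := P.sum_eq
  have h2 := P.sum_sq_eq
  have h3 := P.sum_cube_eq
  have hy := sq_periods_eq P.pos P.card_eq P.generator P.primitive P.charSum_eq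
  simp only [Finset.sum_range_succ, Finset.sum_range_zero, zero_add] at h1 h2 h3
  push_cast at h2 h3
  have heq : ∀ a < 4, ∀ b < 4, 0 < P.η a → 0 < P.η b → P.η a = P.η b := fun a ha b hb ha0 hb0 =>
    (h a ha ha0).trans (h b hb hb0).symm
  have hbad : ∀ a b : ℤ, 3 * a + b = P.η 0 + P.η 1 + P.η 2 + P.η 3 →
      3 * a ^ 2 + b ^ 2 = P.η 0 ^ 2 + P.η 1 ^ 2 + P.η 2 ^ 2 + P.η 3 ^ 2 →
      3 * a ^ 3 + b ^ 3 = P.η 0 ^ 3 + P.η 1 ^ 3 + P.η 2 ^ 3 + P.η 3 ^ 3 → False :=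
    fun a b e1 e2 e3 => four_periods_ne hp hq hT (e1.trans h1) (e2.trans h2) (e3.trans h3)
  intro j hj hj0
  rcases le_or_gt 0 (P.η 0 + P.η 2) with hac | hac
  · rcases four_periods_cases h1 (by linarith) hy hac (h0 0) (h0 1) (h0 2) (h0 3)
      (heq 0 (by norm_num) 2 (by norm_num)) (heq 0 (by norm_num) 1 (by norm_num))
      (heq 0 (by norm_num) 3 (by norm_num)) (heq 2 (by norm_num) 1 (by norm_num))
      (heq 2 (by norm_num) 3 (by norm_num)) with h | h | h | h
    · interval_cases i <;> interval_cases j <;> first | rfl | omega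
    · interval_cases i <;> interval_cases j <;> first | rfl | omega
    · exact (hbad (P.η 0) (P.η 3) (by rw [← h.1, ← h.2]; ring) (by rw [← h.1, ← h.2]; ring)
        (by rw [← h.1, ← h.2]; ring)).elim
    · exact (hbad (P.η 0) (P.η 1) (by rw [← h.1, ← h.2]; ring) (by rw [← h.1, ← h.2]; ring)
        (by rw [← h.1, ← h.2]; ring)).elim
  -- The quadratic periods sum to `-1`, so now `η 1 + η 3` is the nonnegative one; rotate the
  -- indices.
  · have hy' : (2 * (P.η 1 + P.η 3) + 1) ^ 2 = (4 * n + 1 : ℤ) := by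
      rw [← hy, (by linarith : P.η 1 + P.η 3 = -1 - (P.η 0 + P.η 2))]
      ring
    rcases four_periods_cases (a := P.η 1) (b := P.η 2) (c := P.η 3) (d := P.η 0) (n := n)
      (by linarith) (by linarith) hy' (by omega) (h0 1) (h0 2) (h0 3) (h0 0)
      (heq 1 (by norm_num) 3 (by norm_num)) (heq 1 (by norm_num) 2 (by norm_num))
      (heq 1 (by norm_num) 0 (by norm_num)) (heq 3 (by norm_num) 2 (by norm_num))
      (heq 3 (by norm_num) 0 (by norm_num)) with h | h | h | h
    · interval_cases i <;> interval_cases j <;> first | rfl | omega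
    · interval_cases i <;> interval_cases j <;> first | rfl | omega
    · exact (hbad (P.η 1) (P.η 0) (by rw [← h.1, ← h.2]; ring) (by rw [← h.1, ← h.2]; ring)
        (by rw [← h.1, ← h.2]; ring)).elim
    · exact (hbad (P.η 1) (P.η 2) (by rw [← h.1, ← h.2]; ring) (by rw [← h.1, ← h.2]; ring)
        (by rw [← h.1, ← h.2]; ring)).elim

/-- The periods exist and are nonzero as soon as the prime field consists of
`k`-th powers. -/
lemma exists_paleyPeriods {p k n : ℕ} [Fact p.Prime] [CharP F p]
    (hkn : Fintype.card F = k * n + 1) (hk : 2 < k) (hn : k ≤ n) (heven : Even n)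
    (hpn : p - 1 ∣ n) : ∃ P : PaleyPeriods k n F, ∀ i, P.η i ≠ 0 := by
  have hn0 : 0 < n := by omega
  obtain ⟨g, hg⟩ := exists_isPrimitiveRoot_card_sub_one F
  rw [hkn, Nat.add_sub_cancel] at hg
  choose z hz hzn using exists_int_charSum_powers (p := p) hn0 hkn hpn
    (AddChar.FiniteField.primitiveChar_to_Complex F)
  refine ⟨⟨_, AddChar.FiniteField.primitiveChar_to_Complex_isPrimitive F, g, hg,
    fun i => z (g ^ i), fun i => hz _, hn, hk, hkn, heven⟩, fun i hi => ?_⟩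
  have h1 := hzn (g ^ i)
  simp only at hi
  rw [hi, zero_sub, dvd_neg, Int.natCast_dvd_natCast] at h1
  have h2 : p ∣ k * n + 1 := by
    rw [← hkn, ← CharP.cast_eq_zero_iff F p]
    simp
  -- A zero period would give `p ∣ n`, which is incompatible with `p ∣ k * n + 1`.
  have h3 := (Nat.dvd_add_right (h1.mul_left k)).1 h2
  exact (Fact.out : p.Prime).one_lt.ne' (Nat.dvd_one.1 h3)

theorem PaleyPeriods.equienergetic_and_not_isospectral {k n : ℕ} (P : PaleyPeriods k n F) :
    Equienergetic (gpGraph k F) (complement (gpGraph k F)) →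
      (Equienergetic (gpGraph k F) (gpSumGraph k F) ∧
        Equienergetic (gpGraph k F) (complement (gpGraph k F)) ∧
        Equienergetic (gpSumGraph k F) (complement (gpGraph k F))) ∧
      (¬ Isospectral (gpGraph k F) (gpSumGraph k F) ∧
        ¬ Isospectral (gpGraph k F) (complement (gpGraph k F)) ∧
        ¬ Isospectral (gpSumGraph k F) (complement (gpGraph k F))) := by
  intro h
  refine ⟨⟨P.equienergetic_sumGraph, h, rfl, P.equienergetic_sumGraph.2.symm.trans h.2⟩,
    fun h' => ?_, P.not_isospectral_complement, fun h' => ?_⟩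
  · exact P.sum_spec_sumGraph_ne_zero ((congrArg Multiset.sum h').symm.trans (sum_spec_gpGraph k))
  · exact P.sum_spec_sumGraph_ne_zero (Eq.trans (congrArg Multiset.sum h') (sum_spec_complement _))

end PaleyGraph

end PaleyEnergy

/-! ### The main theorem. -/

open PaleyEnergy in
theorem theorem4p2 (p m q k : ℕ) (hp : p.Prime) (hm : 0 < m) (hq : q = p ^ m)
    (F : Type*) [Field F] [Fintype F] (hF : Fintype.card F = q)
    (hk : k = 3 ∨ k = 4) (hdvd : k ∣ (q - 1) / (p - 1))
    (hsp : ¬ PaleyEnergy.IsSemiprimitivePair k q) :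
    (PaleyEnergy.Equienergetic (PaleyEnergy.gpGraph k F)
        (PaleyEnergy.complement (PaleyEnergy.gpGraph k F)) ↔
      ∃! x : ℝ, PaleyEnergy.IsNonPrincipalEigenvalue (PaleyEnergy.gpGraph k F) x ∧ 0 < x) ∧
    (PaleyEnergy.Equienergetic (PaleyEnergy.gpGraph k F)
        (PaleyEnergy.complement (PaleyEnergy.gpGraph k F)) →
      (PaleyEnergy.Equienergetic (PaleyEnergy.gpGraph k F) (PaleyEnergy.gpSumGraph k F) ∧
        PaleyEnergy.Equienergetic (PaleyEnergy.gpGraph k F)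
          (PaleyEnergy.complement (PaleyEnergy.gpGraph k F)) ∧
        PaleyEnergy.Equienergetic (PaleyEnergy.gpSumGraph k F)
          (PaleyEnergy.complement (PaleyEnergy.gpGraph k F))) ∧
      (¬ PaleyEnergy.Isospectral (PaleyEnergy.gpGraph k F) (PaleyEnergy.gpSumGraph k F) ∧
        ¬ PaleyEnergy.Isospectral (PaleyEnergy.gpGraph k F)
          (PaleyEnergy.complement (PaleyEnergy.gpGraph k F)) ∧
        ¬ PaleyEnergy.Isospectral (PaleyEnergy.gpSumGraph k F)
          (PaleyEnergy.complement (PaleyEnergy.gpGraph k F)))) := by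
  subst hq
  obtain ⟨n, hqn, hkn, heven, hpn, hkp⟩ :=
    arithmetic_of_not_isSemiprimitivePair hp hm hk hdvd hsp
  have : Fact p.Prime := ⟨hp⟩
  have : CharP F p := charP_of_card_eq_prime_pow hF
  have hcard : Fintype.card F = k * n + 1 := hF.trans hqn
  have hk2 : 2 < k := by omega
  obtain ⟨P, h0⟩ := exists_paleyPeriods hcard hk2 hkn heven hpn
  refine ⟨P.equienergetic_complement_iff_existsUnique h0 ?_, P.equienergetic_and_not_isospectral⟩
  have hpz : Prime (p : ℤ) := Nat.prime_iff_prime_int.1 hp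
  have hpq : p ∣ k * n + 1 := hqn ▸ dvd_pow_self p hm.ne'
  have hC : ((2 * n).choose n : F) ≠ 0 := by
    rw [Ne, CharP.cast_eq_zero_iff F p]
    exact not_dvd_choose_two_mul hp hk2.le hkp hqn
  rcases hk with rfl | rfl
  · refine P.three_separated hpz (by exact_mod_cast hpq) fun h => hC ?_
    have h1 : ((9 * powersCount 3 F + 8 : ℕ) : F) = 0 :=
      (CharP.cast_eq_zero_iff F p _).2 (by exact_mod_cast h)
    have h2 := three_powersCount P.pos hcard heven
    push_cast at h1
    rwa [h1, zero_add] at h2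
  · refine P.four_separated hpz (by exact_mod_cast hpq) (fun h => hC ?_) h0
    have h1 : ((16 * powersCount 4 F + 11 : ℕ) : F) = 0 :=
      (CharP.cast_eq_zero_iff F p _).2 (by exact_mod_cast h)
    have h2 := four_powersCount P.pos hcard heven
    push_cast at h1
    rw [h1, zero_add] at h2
    -- The factor `3` is invertible, since `4 ∣ p - 1` excludes `p = 3`.
    have h3 : (3 : F) ≠ 0 := by
      intro h3
      have h4 : p ∣ 3 := (CharP.cast_eq_zero_iff F p 3).1 (by exact_mod_cast h3)
      rw [Nat.prime_dvd_prime_iff_eq hp Nat.prime_three] at h4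
      subst h4
      omega
    exact (mul_eq_zero.1 h2).resolve_left h3
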